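/- Let $\mathcal K$ be a nonempty finite set of models. For each $k\in\mathcal K$ let $\Psi_k$ be a nonzero finite measure on a measurable space $(\mathsf Z_k,\mathcal A_k)$, and let $\Phi_k=\Psi_k/\Psi_k(\mathsf Z_k)$. Let $\mathsf X=\bigcup_{k}\{k\}\times\mathsf Z_k$ carry the $\sigma$-algebra generated by the sets $\{k\}\times A$ ($k\in\mathcal K$, $A\in\mathcal A_k$), and let $\Pi$ be the probability measure on $\mathsf X$ with $\Pi(\{k\}\times A)=\Psi_k(A)/\sum_{k'}\Psi_{k'}(\mathsf Z_{k'})$. Let $P$ be a Markov transition kernel on $\mathsf X$ with $\Pi P=\Pi$. Let $\Gamma_P=(\gamma_{k,k'})_{k,k'\in\mathcal K}$, where $\gamma_{k,k'}=1$ if $\int_{\mathsf Z_k}\Psi_k(dz)\,P((k,z),\{k'\}\times\mathsf Z_{k'})>0$ and $\gamma_{k,k'}=0$ otherwise. For a Markov transition kernel $T$ with stationary probability measure $\omega$, let $T^t$ be the $t$-step kernel, let $L_0^2(\omega)$ be the space of real $f\in L^2(\omega)$ with $\int f\,d\omega=0$, let $(Tf)(y)=\int f(x)\,T(y,dx)$,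 and let $\|T\|_\omega=\sup\{\|Tf\|_{L^2(\omega)}/\|f\|_{L^2(\omega)} : 0\ne f\in L_0^2(\omega)\}$ (with $\sup\emptyset=0$). Let $L^2_*(\omega)$ be the set of probability measures $\mu\ll\omega$ with $d\mu/d\omega\in L^2(\omega)$, and for $\mu,\nu\in L_*^2(\omega)$ let $\|\mu-\nu\|_\omega=\sup\{|\mu f-\nu f| : f\in L^2(\omega),\ \|f\|_{L^2(\omega)}=1\}$. The kernel $T$ is called $L^2(\omega)$ geometrically convergent if there are $\rho\in[0,1)$ and $C:L_*^2(\omega)\to[0,\infty)$ such that $\|\mu T^t-\omega\|_\omega\le C(\mu)\rho^t$ for all $\mu\in L_*^2(\omega)$ and all integers $t\ge0$. **Theorem 1.** Assume: (H1) for each $k\in\mathcal K$ there are a Markov transition kernel $P_k$ on $\mathsf Z_k$, a positive integer $t_k$ and a constant $c_k>0$ such that (i) $\Phi_kP_k=\Phi_k$; (ii) $\|P_k^{t_k}\|_{\Phi_k}<1$; (iii) $P((k,z),\{k\}\times A)\ge c_kP_k(z,A)$ for all $z\in\mathsf Z_k$ and $A\in\mathcal A_k$; (H2) for some positive integer $s$,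 every entry of the matrix $\Gamma_P^s$ is positive. Then $\|P^t\|_\Pi<1$ for every integer $t\ge\max_{k}t_k$ (in particular for $t$ itself if $t_k=t$ for all $k$), and $P$ is $L^2(\Pi)$ geometrically convergent. -/

import Mathlib

open MeasureTheory ProbabilityTheory
open scoped ENNReal NNReal

namespace TransDim

noncomputable section

/-! ### L² theory of Markov transition kernels on a general probability space -/

/-- The `t`-step transition kernel: `T⁰(y, ·)` is the point mass at `y`, and
`Tᵗ⁺¹(y, ·) = ∫ Tᵗ(y, dy') T(y', ·)`. -/
def kpow {Y : Type*} [MeasurableSpace Y] (T : Kernel Y Y) : ℕ → Kernel Y Y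
  | 0 => Kernel.id
  | t + 1 => T ∘ₖ kpow T t

/-- The operator norm of `f ↦ T f`, `(T f)(y) = ∫ f(x) T(y, dx)`, on `L₀²(ω)` (the real square
integrable functions of mean zero): the supremum of `‖T f‖ / ‖f‖` over the nonzero `f ∈ L₀²(ω)`.
It is an extended nonnegative real, and it is `0` if `L₀²(ω)` is trivial. -/
def mtkNorm {Y : Type*} [MeasurableSpace Y] (T : Kernel Y Y) (ω : Measure Y) : ℝ≥0∞ :=
  ⨆ (f : Y → ℝ) (_ : MemLp f 2 ω) (_ : ∫ y, f y ∂ω = 0) (_ : eLpNorm f 2 ω ≠ 0),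
    eLpNorm (fun y => ∫ x, f x ∂(T y)) 2 ω / eLpNorm f 2 ω

/-- `μ ∈ L⁎²(ω)`: `μ` is a probability measure whose density `dμ/dω` exists and is in `L²(ω)`. -/
def MemLTwoStar {Y : Type*} [MeasurableSpace Y] (ω μ : Measure Y) : Prop :=
  IsProbabilityMeasure μ ∧ μ ≪ ω ∧ MemLp (fun y => (μ.rnDeriv ω y).toReal) 2 ω

/-- The `L²` distance of `μ, ν ∈ L⁎²(ω)`: the supremum of `|μ f - ν f|` over the `f ∈ L²(ω)` of
norm one. -/
def lTwoDist {Y : Type*} [MeasurableSpace Y] (ω μ ν : Measure Y) : ℝ≥0∞ :=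
  ⨆ (f : Y → ℝ) (_ : MemLp f 2 ω) (_ : eLpNorm f 2 ω = 1),
    ENNReal.ofReal |∫ y, f y ∂μ - ∫ y, f y ∂ν|

/-- `T` is `L²(ω)` geometrically convergent: there are `ρ < 1` and `C : L⁎²(ω) → [0, ∞)` such that
`‖μ Tᵗ - ω‖ ≤ C(μ) ρᵗ` for all `μ ∈ L⁎²(ω)` and `t ≥ 0`. -/
def LTwoGeomConvergent {Y : Type*} [MeasurableSpace Y] (T : Kernel Y Y) (ω : Measure Y) : Prop :=
  ∃ ρ : ℝ≥0, ρ < 1 ∧ ∃ C : Measure Y → ℝ≥0, ∀ μ : Measure Y, MemLTwoStar ω μ → ∀ t : ℕ,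
    lTwoDist ω (μ.bind (kpow T t)) ω ≤ (C μ : ℝ≥0∞) * (ρ : ℝ≥0∞) ^ t

/-! ### The trans-dimensional setting

The state space is the disjoint union `Σ k, Z k`, with the σ-algebra of the sets all of whose
slices are measurable; for countably many models this is the one generated by the sets
`{k} × A = Sigma.mk k '' A`. -/

/-- `Φ = Ψ / Ψ(univ)`, the normalization of a nonzero finite measure. -/
def normalized {Y : Type*} [MeasurableSpace Y] (Ψ : Measure Y) : Measure Y :=
  (Ψ Set.univ)⁻¹ • Ψ

/-- The target `Π({k} × A) = Ψ_k(A) / ∑_k' Ψ_k'(Z_k')`. -/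
def target {K : Type*} [Fintype K] {Z : K → Type*} [∀ k, MeasurableSpace (Z k)]
    (Ψ : ∀ k, Measure (Z k)) : Measure (Σ k, Z k) :=
  (∑ k, Ψ k Set.univ)⁻¹ • ∑ k, (Ψ k).map (Sigma.mk k)

open Classical in
/-- The model-transition indicator matrix: the entry at `(k, k')` is `1` if
`∫ Ψ_k(dz) P((k, z), {k'} × Z_k') > 0` and `0` otherwise. -/
def modelMatrix {K : Type*} {Z : K → Type*} [∀ k, MeasurableSpace (Z k)]
    (Ψ : ∀ k, Measure (Z k)) (P : Kernel (Σ k, Z k) (Σ k, Z k)) : Matrix K K ℕ :=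
  Matrix.of fun k k' =>
    if 0 < ∫⁻ z, P ⟨k, z⟩ (Sigma.mk k' '' Set.univ) ∂(Ψ k) then 1 else 0

end

end TransDim

/-! The argument is an energy estimate. With `dirichlet T ω f` the mean of the variances of `f`
under `T(y, ·)`, invariance alone gives `‖f‖² - ‖T f‖² = dirichlet T ω f` (`dirichlet_eq`);
reversibility plays no role. So if `δ = ‖f‖² - ‖P^t f‖²` is the loss over `t` steps, each `P^i f`
with `i < t` has energy at most `δ`. It suffices to prove `‖f‖² ≤ C δ` for `f` of mean zero, with
`C` independent of `f`.

Within a model, the minorization forces `P(x, ·)`-variance to dominate both the local variance and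
the squared gap between the local and global averages (`mul_sq_sub_add_variance_le`). Small energies
along the `P`-orbit thus keep the local orbit close to it and make the local loss `O(δ)`
(`exists_integral_sq_sub_iterate_le`). The local contraction then bounds the variance of `f` on each
component (`exists_variance_slice_le`).

Between models, `f` is now `L²`-close to its component means `m`, so `m` has energy `O(δ)`. A
possible jump from `k` to `k'`, together with the chance of staying in `k`, bounds `(m k - m k')²`
by that energy (`exists_sq_sub_le_dirichlet`). Irreducibility extends this to all pairs, and mean
zero turns small differences into small values (`exists_integral_sq_le`).

Geometric convergence follows by duality from the contraction of one power of `P`. -/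

namespace TransDim

/-! ### Markov operators on `L²` and the Dirichlet form -/

section Operator

variable {Y : Type*} [MeasurableSpace Y]

/-- The operator `f ↦ T f`, `(T f)(y) = ∫ f(x) T(y, dx)`. -/
noncomputable def kernelOp (T : Kernel Y Y) (f : Y → ℝ) : Y → ℝ :=
  fun y => ∫ x, f x ∂(T y)

/-- The Dirichlet form `∫ Var_{T(y, ·)}(f) ω(dy)`. -/
noncomputable def dirichlet (T : Kernel Y Y) (ω : Measure Y) (f : Y → ℝ) : ℝ :=
  ∫ y, Var[f; T y] ∂ω

lemma integrable_integral_bind {T : Kernel Y Y} {μ : Measure Y} {f : Y → ℝ}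
    (hf : Integrable f (μ.bind T)) : Integrable (fun y => ∫ x, f x ∂(T y)) μ := by
  rw [Measure.comp_eq_comp_const_apply] at hf
  exact hf.integral_comp

lemma integral_bind_kernel {T : Kernel Y Y} {μ : Measure Y} {f : Y → ℝ}
    (hf : Integrable f (μ.bind T)) : ∫ x, f x ∂(μ.bind T) = ∫ y, ∫ x, f x ∂(T y) ∂μ := by
  rw [Measure.comp_eq_comp_const_apply] at hf ⊢
  exact Kernel.integral_comp hf

variable {T : Kernel Y Y} {ω : Measure Y}

/-- By invariance `f²` is integrable for `ω T = ω`, hence for almost every `T(y, ·)`; measurability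
of `f` for `T(y, ·)` comes from a representative in the same way. -/
lemma ae_memLp_two [IsMarkovKernel T] (hT : T.Invariant ω) {f : Y → ℝ} (hf : MemLp f 2 ω) :
    ∀ᵐ y ∂ω, MemLp f 2 (T y) := by
  have hm : AEStronglyMeasurable f (ω.bind T) := by rw [hT.def]; exact hf.1
  have h2 : Integrable (fun y => f y ^ 2) (ω.bind T) := by rw [hT.def]; exact hf.integrable_sq
  have h1 : ∀ᵐ y ∂ω, f =ᵐ[T y] hm.mk f := Measure.ae_ae_of_ae_comp hm.ae_eq_mk
  filter_upwards [Measure.ae_integrable_of_integrable_comp h2, h1] with y hy hy1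
  exact (memLp_two_iff_integrable_sq ⟨_, hm.stronglyMeasurable_mk, hy1⟩).2 hy

lemma kernelOp_congr_ae (hT : T.Invariant ω) {f g : Y → ℝ} (h : f =ᵐ[ω] g) :
    kernelOp T f =ᵐ[ω] kernelOp T g := by
  have h' : ∀ᵐ y ∂(ω.bind T), f y = g y := by rw [hT.def]; exact h
  filter_upwards [Measure.ae_ae_of_ae_comp h'] with y hy
  exact integral_congr_ae hy

lemma integral_kernelOp (hT : T.Invariant ω) {f : Y → ℝ} (hf : Integrable f ω) :
    ∫ y, kernelOp T f y ∂ω = ∫ y, f y ∂ω := by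
  conv_rhs => rw [← hT.def]
  rw [integral_bind_kernel (by rwa [hT.def])]
  rfl

lemma integrable_kernelOp (hT : T.Invariant ω) {f : Y → ℝ} (hf : Integrable f ω) :
    Integrable (kernelOp T f) ω :=
  integrable_integral_bind (by rwa [hT.def])

lemma sq_integral_le {μ : Measure Y} [IsProbabilityMeasure μ] {f : Y → ℝ} (hf : MemLp f 2 μ) :
    (∫ x, f x ∂μ) ^ 2 ≤ ∫ x, f x ^ 2 ∂μ := by
  have h := variance_nonneg f μ
  rw [variance_eq_sub hf] at h
  simpa using h

lemma memLp_kernelOp [IsMarkovKernel T] [IsFiniteMeasure ω] (hT : T.Invariant ω) {f : Y → ℝ}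
    (hf : MemLp f 2 ω) : MemLp (kernelOp T f) 2 ω := by
  have h1 := integrable_kernelOp hT (hf.integrable one_le_two)
  rw [memLp_two_iff_integrable_sq h1.1]
  refine (integrable_kernelOp hT hf.integrable_sq).mono' (h1.1.pow 2) ?_
  filter_upwards [ae_memLp_two hT hf] with y hy
  rw [Real.norm_of_nonneg (sq_nonneg _)]
  exact sq_integral_le hy

lemma memLp_kernelOp_iterate [IsMarkovKernel T] [IsFiniteMeasure ω] (hT : T.Invariant ω)
    {f : Y → ℝ} (hf : MemLp f 2 ω) (n : ℕ) : MemLp ((kernelOp T)^[n] f) 2 ω := by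
  induction n generalizing f with
  | zero => exact hf
  | succ n ih => exact ih (memLp_kernelOp hT hf)

lemma integral_kernelOp_iterate [IsMarkovKernel T] [IsFiniteMeasure ω] (hT : T.Invariant ω)
    {f : Y → ℝ} (hf : MemLp f 2 ω) (n : ℕ) : ∫ y, (kernelOp T)^[n] f y ∂ω = ∫ y, f y ∂ω := by
  induction n generalizing f with
  | zero => rfl
  | succ n ih =>
    rw [Function.iterate_succ_apply, ih (memLp_kernelOp hT hf),
      integral_kernelOp hT (hf.integrable one_le_two)]

lemma kernelOp_sub_ae [IsMarkovKernel T] [IsFiniteMeasure ω] (hT : T.Invariant ω)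
    {f g : Y → ℝ} (hf : MemLp f 2 ω) (hg : MemLp g 2 ω) :
    kernelOp T (f - g) =ᵐ[ω] kernelOp T f - kernelOp T g := by
  filter_upwards [ae_memLp_two hT hf, ae_memLp_two hT hg] with y h1 h2
  exact integral_sub (h1.integrable one_le_two) (h2.integrable one_le_two)

lemma kernelOp_iterate_congr_ae (hT : T.Invariant ω) {f g : Y → ℝ} (h : f =ᵐ[ω] g) (n : ℕ) :
    (kernelOp T)^[n] f =ᵐ[ω] (kernelOp T)^[n] g := by
  induction n generalizing f g with
  | zero => exact h
  | succ n ih => exact ih (kernelOp_congr_ae hT h)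

lemma kernelOp_iterate_sub_ae [IsMarkovKernel T] [IsFiniteMeasure ω] (hT : T.Invariant ω)
    {f g : Y → ℝ} (hf : MemLp f 2 ω) (hg : MemLp g 2 ω) (n : ℕ) :
    (kernelOp T)^[n] (f - g) =ᵐ[ω] (kernelOp T)^[n] f - (kernelOp T)^[n] g := by
  induction n generalizing f g with
  | zero => rfl
  | succ n ih =>
    exact (kernelOp_iterate_congr_ae hT (kernelOp_sub_ae hT hf hg) n).trans
      (ih (memLp_kernelOp hT hf) (memLp_kernelOp hT hg))

lemma kernelOp_iterate_const [IsMarkovKernel T] (c : ℝ) (n : ℕ) :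
    (kernelOp T)^[n] (fun _ => c) = fun _ => c :=
  Function.iterate_fixed (by ext y; simp [kernelOp]) n

lemma variance_ae_eq [IsMarkovKernel T] (hT : T.Invariant ω) {f : Y → ℝ} (hf : MemLp f 2 ω) :
    (fun y => Var[f; T y]) =ᵐ[ω]
      fun y => kernelOp T (fun x => f x ^ 2) y - kernelOp T f y ^ 2 := by
  filter_upwards [ae_memLp_two hT hf] with y hy
  rw [variance_eq_sub hy]
  rfl

lemma integrable_variance [IsMarkovKernel T] [IsFiniteMeasure ω] (hT : T.Invariant ω) {f : Y → ℝ}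
    (hf : MemLp f 2 ω) : Integrable (fun y => Var[f; T y]) ω :=
  ((integrable_kernelOp hT hf.integrable_sq).sub (memLp_kernelOp hT hf).integrable_sq).congr
    (variance_ae_eq hT hf).symm

lemma dirichlet_eq [IsMarkovKernel T] [IsFiniteMeasure ω] (hT : T.Invariant ω) {f : Y → ℝ}
    (hf : MemLp f 2 ω) :
    dirichlet T ω f = ∫ y, f y ^ 2 ∂ω - ∫ y, kernelOp T f y ^ 2 ∂ω := by
  rw [dirichlet, integral_congr_ae (variance_ae_eq hT hf),
    integral_sub (integrable_kernelOp hT hf.integrable_sq) (memLp_kernelOp hT hf).integrable_sq,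
    integral_kernelOp hT hf.integrable_sq]

lemma dirichlet_nonneg (f : Y → ℝ) : 0 ≤ dirichlet T ω f :=
  integral_nonneg fun _ => variance_nonneg _ _

lemma integral_sq_kernelOp_le [IsMarkovKernel T] [IsFiniteMeasure ω] (hT : T.Invariant ω)
    {f : Y → ℝ} (hf : MemLp f 2 ω) : ∫ y, kernelOp T f y ^ 2 ∂ω ≤ ∫ y, f y ^ 2 ∂ω := by
  have := dirichlet_nonneg (T := T) (ω := ω) f
  rw [dirichlet_eq hT hf] at this
  linarith

lemma antitone_integral_sq_iterate [IsMarkovKernel T] [IsFiniteMeasure ω] (hT : T.Invariant ω)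
    {f : Y → ℝ} (hf : MemLp f 2 ω) :
    Antitone fun n => ∫ y, (kernelOp T)^[n] f y ^ 2 ∂ω := by
  refine antitone_nat_of_succ_le fun n => ?_
  rw [Function.iterate_succ_apply']
  exact integral_sq_kernelOp_le hT (memLp_kernelOp_iterate hT hf n)

/-- The energy at step `n` is one decrement of the decreasing sequence `‖T^i f‖²`, so the total
decrement over `t` steps bounds it. -/
lemma dirichlet_iterate_le [IsMarkovKernel T] [IsFiniteMeasure ω] (hT : T.Invariant ω)
    {f : Y → ℝ} (hf : MemLp f 2 ω) {n t : ℕ} (hn : n < t) :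
    dirichlet T ω ((kernelOp T)^[n] f) ≤
      ∫ y, f y ^ 2 ∂ω - ∫ y, (kernelOp T)^[t] f y ^ 2 ∂ω := by
  rw [dirichlet_eq hT (memLp_kernelOp_iterate hT hf n), ← Function.iterate_succ_apply' (kernelOp T)]
  have h1 := antitone_integral_sq_iterate hT hf (Nat.zero_le n)
  have h2 := antitone_integral_sq_iterate hT hf (Nat.succ_le_of_lt hn)
  exact sub_le_sub h1 h2

lemma variance_le_two_mul_add {μ : Measure Y} [IsProbabilityMeasure μ] {f g : Y → ℝ}
    (hf : MemLp f 2 μ) (hg : MemLp g 2 μ) :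
    Var[f; μ] ≤ 2 * Var[g; μ] + 2 * ∫ x, (f x - g x) ^ 2 ∂μ := by
  have h1 := variance_add (hf.sub hg) hg
  have h2 := variance_sub (hf.sub hg) hg
  have h3 := variance_nonneg (f - g - g) μ
  have h4 := variance_eq_sub (hf.sub hg)
  have h5 : ∫ x, ((f - g) ^ 2) x ∂μ = ∫ x, (f x - g x) ^ 2 ∂μ := rfl
  rw [h5] at h4
  rw [sub_add_cancel] at h1
  -- Parallelogram law for the variance, applied to `f - g` and `g`; then a variance is at most a
  -- second moment.
  nlinarith [sq_nonneg (∫ x, (f - g) x ∂μ)]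

lemma dirichlet_le_two_mul_add [IsMarkovKernel T] [IsFiniteMeasure ω] (hT : T.Invariant ω)
    {f g : Y → ℝ} (hf : MemLp f 2 ω) (hg : MemLp g 2 ω) :
    dirichlet T ω f ≤ 2 * dirichlet T ω g + 2 * ∫ x, (f x - g x) ^ 2 ∂ω := by
  have hfg : Integrable (fun x => (f x - g x) ^ 2) ω := (hf.sub hg).integrable_sq
  rw [← integral_kernelOp hT hfg, dirichlet, dirichlet, ← integral_const_mul, ← integral_const_mul,
    ← integral_add ((integrable_variance hT hg).const_mul 2)
      ((integrable_kernelOp hT hfg).const_mul 2)]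
  refine integral_mono_ae (integrable_variance hT hf)
    (((integrable_variance hT hg).const_mul 2).add ((integrable_kernelOp hT hfg).const_mul 2)) ?_
  filter_upwards [ae_memLp_two hT hf, ae_memLp_two hT hg] with y h1 h2
  exact variance_le_two_mul_add h1 h2

lemma integral_add_sq_le {f g : Y → ℝ} (hf : MemLp f 2 ω) (hg : MemLp g 2 ω) :
    ∫ y, (f y + g y) ^ 2 ∂ω ≤ 2 * ∫ y, f y ^ 2 ∂ω + 2 * ∫ y, g y ^ 2 ∂ω := by
  rw [← integral_const_mul, ← integral_const_mul,
    ← integral_add (hf.integrable_sq.const_mul 2) (hg.integrable_sq.const_mul 2)]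
  refine integral_mono (hf.add hg).integrable_sq
    ((hf.integrable_sq.const_mul 2).add (hg.integrable_sq.const_mul 2)) fun y => ?_
  beta_reduce
  nlinarith [sq_nonneg (f y - g y)]

/-! ### Powers of a kernel and the operator norm -/

instance isMarkovKernel_kpow [IsMarkovKernel T] (n : ℕ) : IsMarkovKernel (kpow T n) := by
  induction n with
  | zero => unfold kpow; infer_instance
  | succ n ih => unfold kpow; infer_instance

lemma invariant_kpow (hT : T.Invariant ω) (n : ℕ) : (kpow T n).Invariant ω := by
  induction n with
  | zero => exact Measure.bind_dirac (m := ω)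
  | succ n ih => exact hT.comp ih

/-- The identity is proved first for measurable functions, which integration against a point mass
requires, then carried to almost-everywhere classes by invariance. -/
lemma kernelOp_kpow_ae [IsMarkovKernel T] [IsFiniteMeasure ω] (hT : T.Invariant ω)
    {f : Y → ℝ} (hf : MemLp f 2 ω) (n : ℕ) :
    kernelOp (kpow T n) f =ᵐ[ω] (kernelOp T)^[n] f := by
  have key : ∀ n, ∀ g : Y → ℝ, Measurable g → MemLp g 2 ω →
      kernelOp (kpow T n) g =ᵐ[ω] (kernelOp T)^[n] g := by
    intro n
    induction n with
    | zero =>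
      intro g hg _
      refine ae_of_all _ fun y => ?_
      simp only [kernelOp, kpow, Kernel.id_apply, Function.iterate_zero, id]
      exact integral_dirac' _ _ hg.stronglyMeasurable
    | succ n ih =>
      intro g hg hg2
      have hm : Measurable (kernelOp T g) := hg.stronglyMeasurable.integral_kernel.measurable
      refine Filter.EventuallyEq.trans ?_ (ih (kernelOp T g) hm (memLp_kernelOp hT hg2))
      filter_upwards [ae_memLp_two (invariant_kpow hT (n + 1)) hg2] with y hy
      exact Kernel.integral_comp (hy.integrable one_le_two)
  have hm := hf.1.aemeasurable
  refine (kernelOp_congr_ae (invariant_kpow hT n) hm.ae_eq_mk).trans ?_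
  refine (key n _ hm.measurable_mk (hf.ae_eq hm.ae_eq_mk)).trans ?_
  exact kernelOp_iterate_congr_ae hT hm.ae_eq_mk.symm n

lemma eLpNorm_two_eq {f : Y → ℝ} (hf : MemLp f 2 ω) :
    eLpNorm f 2 ω = ENNReal.ofReal (√(∫ y, f y ^ 2 ∂ω)) := by
  rw [hf.eLpNorm_eq_integral_rpow_norm two_ne_zero ENNReal.ofNat_ne_top]
  simp [Real.sqrt_eq_rpow]

lemma mtkNorm_le_iff [IsMarkovKernel T] [IsFiniteMeasure ω] (hT : T.Invariant ω) (n : ℕ)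
    {r : ℝ} (hr : 0 ≤ r) :
    mtkNorm (kpow T n) ω ≤ ENNReal.ofReal (√r) ↔
      ∀ f : Y → ℝ, MemLp f 2 ω → ∫ y, f y ∂ω = 0 →
        ∫ y, (kernelOp T)^[n] f y ^ 2 ∂ω ≤ r * ∫ y, f y ^ 2 ∂ω := by
  simp only [mtkNorm, iSup_le_iff]
  refine forall₃_congr fun f hf hf0 => ?_
  have e1 : eLpNorm (fun y => ∫ x, f x ∂(kpow T n y)) 2 ω =
      ENNReal.ofReal (√(∫ y, (kernelOp T)^[n] f y ^ 2 ∂ω)) := by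
    rw [← eLpNorm_two_eq (memLp_kernelOp_iterate hT hf n)]
    exact eLpNorm_congr_ae (kernelOp_kpow_ae hT hf n)
  have hA : 0 ≤ ∫ y, f y ^ 2 ∂ω := integral_nonneg fun _ => sq_nonneg _
  have hB := antitone_integral_sq_iterate hT hf (Nat.zero_le n)
  simp only [Function.iterate_zero, id] at hB
  rw [e1]
  -- The supremum omits functions of norm zero; for those the quadratic inequality holds trivially.
  rcases hA.eq_or_lt with h0 | h0
  · rw [← h0] at hB ⊢
    simp [eLpNorm_two_eq hf, ← h0, hB]
  · have hp : 0 < √(∫ y, f y ^ 2 ∂ω) := Real.sqrt_pos.2 h0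
    rw [eLpNorm_two_eq hf, ENNReal.div_le_iff (by simpa using h0) ENNReal.ofReal_ne_top,
      ← ENNReal.ofReal_mul (Real.sqrt_nonneg _), ENNReal.ofReal_le_ofReal_iff (by positivity),
      ← Real.sqrt_mul hr, Real.sqrt_le_sqrt_iff (by positivity)]
    simp [h0]

lemma mtkNorm_kpow_lt_one_iff [IsMarkovKernel T] [IsFiniteMeasure ω] (hT : T.Invariant ω) (n : ℕ) :
    mtkNorm (kpow T n) ω < 1 ↔ ∃ r : ℝ, 0 ≤ r ∧ r < 1 ∧
      ∀ f : Y → ℝ, MemLp f 2 ω → ∫ y, f y ∂ω = 0 →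
        ∫ y, (kernelOp T)^[n] f y ^ 2 ∂ω ≤ r * ∫ y, f y ^ 2 ∂ω := by
  constructor
  · intro h
    set a := (mtkNorm (kpow T n) ω).toReal with ha
    have hne : mtkNorm (kpow T n) ω ≠ ∞ := h.ne_top
    have ha1 : a < 1 := by
      rw [ha, ← ENNReal.toReal_one]
      exact (ENNReal.toReal_lt_toReal hne ENNReal.one_ne_top).2 h
    have ha0 : 0 ≤ a := ENNReal.toReal_nonneg
    refine ⟨a ^ 2, sq_nonneg a, by nlinarith, (mtkNorm_le_iff hT n (sq_nonneg a)).1 ?_⟩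
    rw [Real.sqrt_sq ha0, ha, ENNReal.ofReal_toReal hne]
  · rintro ⟨r, hr0, hr1, h⟩
    refine ((mtkNorm_le_iff hT n hr0).2 h).trans_lt ?_
    rw [← ENNReal.ofReal_one, ENNReal.ofReal_lt_ofReal_iff one_pos]
    exact (Real.sqrt_lt' one_pos).2 (by simpa using hr1)

end Operator

end TransDim
namespace TransDim

/-! ### Geometric convergence from a contracting power -/

section GeometricConvergence

variable {Y : Type*} [MeasurableSpace Y] {T : Kernel Y Y} {ω : Measure Y}

lemma abs_integral_mul_le_sqrt {f g : Y → ℝ} (hf : MemLp f 2 ω) (hg : MemLp g 2 ω) :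
    |∫ y, f y * g y ∂ω| ≤ √(∫ y, f y ^ 2 ∂ω) * √(∫ y, g y ^ 2 ∂ω) := by
  have h2 : (2 : ℝ≥0∞) = ENNReal.ofReal 2 := by simp
  rw [h2] at hf hg
  have h := integral_mul_norm_le_Lp_mul_Lq Real.HolderConjugate.two_two hf hg
  refine (abs_integral_le_integral_abs).trans ?_
  simpa [abs_mul, Real.sqrt_eq_rpow] using h

lemma integral_sq_iterate_mul_add_le [IsMarkovKernel T] [IsFiniteMeasure ω] (hT : T.Invariant ω)
    {t : ℕ} {a : ℝ} (ha0 : 0 ≤ a)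
    (ha : ∀ f : Y → ℝ, MemLp f 2 ω → ∫ y, f y ∂ω = 0 →
        ∫ y, (kernelOp T)^[t] f y ^ 2 ∂ω ≤ a * ∫ y, f y ^ 2 ∂ω)
    {f : Y → ℝ} (hf : MemLp f 2 ω) (hf0 : ∫ y, f y ∂ω = 0) (q s : ℕ) :
    ∫ y, (kernelOp T)^[t * q + s] f y ^ 2 ∂ω ≤ a ^ q * ∫ y, f y ^ 2 ∂ω := by
  induction q with
  | zero =>
    have := antitone_integral_sq_iterate hT hf (Nat.zero_le (t * 0 + s))
    simpa using this
  | succ q ih =>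
    have e : t * (q + 1) + s = t + (t * q + s) := by ring
    rw [e, Function.iterate_add_apply]
    refine (ha _ (memLp_kernelOp_iterate hT hf _)
      ((integral_kernelOp_iterate hT hf _).trans hf0)).trans ?_
    calc _ ≤ a * (a ^ q * ∫ y, f y ^ 2 ∂ω) := mul_le_mul_of_nonneg_left ih ha0
      _ = _ := by ring

lemma exists_integral_sq_iterate_le [IsMarkovKernel T] [IsFiniteMeasure ω] (hT : T.Invariant ω)
    {t : ℕ} (ht : 0 < t) (h : mtkNorm (kpow T t) ω < 1) :
    ∃ ρ : ℝ, 0 < ρ ∧ ρ < 1 ∧ ∃ a : ℝ, 0 < a ∧ ∀ f : Y → ℝ, MemLp f 2 ω → ∫ y, f y ∂ω = 0 →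
      ∀ n : ℕ, ∫ y, (kernelOp T)^[n] f y ^ 2 ∂ω ≤ (ρ ^ n * a) ^ 2 * ∫ y, f y ^ 2 ∂ω := by
  obtain ⟨r, hr0, hr1, hr⟩ := (mtkNorm_kpow_lt_one_iff hT t).1 h
  -- Bounding below by `1 / 2` makes the rate positive, so `b` can be inverted.
  set b := max r (1 / 2) with hb
  have hb0 : 0 < b := lt_max_of_lt_right (by norm_num)
  have hb1 : b < 1 := max_lt hr1 (by norm_num)
  have hbf : ∀ f : Y → ℝ, MemLp f 2 ω → ∫ y, f y ∂ω = 0 →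
      ∫ y, (kernelOp T)^[t] f y ^ 2 ∂ω ≤ b * ∫ y, f y ^ 2 ∂ω := fun f hf hf0 =>
    (hr f hf hf0).trans
      (mul_le_mul_of_nonneg_right (le_max_left _ _) (integral_nonneg fun _ => sq_nonneg _))
  have hρt : (b ^ (1 / (2 * t : ℝ))) ^ (2 * t) = b := by
    rw [← Real.rpow_natCast, ← Real.rpow_mul hb0.le]
    have : (t : ℝ) ≠ 0 := by positivity
    rw [show 1 / (2 * (t : ℝ)) * ((2 * t : ℕ) : ℝ) = 1 by push_cast; field_simp, Real.rpow_one]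
  -- With `ρ^(2t) = b`, only `n / t` full blocks contract; the factor `b⁻¹` inside the square pays
  -- for the incomplete block.
  refine ⟨b ^ (1 / (2 * t : ℝ)), by positivity, Real.rpow_lt_one hb0.le hb1 (by positivity),
    √(b⁻¹), by positivity, fun f hf hf0 n => ?_⟩
  set ρ := b ^ (1 / (2 * t : ℝ))
  have hρ0 : 0 < ρ := Real.rpow_pos_of_pos hb0 _
  have hρ1 : ρ < 1 := Real.rpow_lt_one hb0.le hb1 (by positivity)
  have hn := integral_sq_iterate_mul_add_le hT hb0.le hbf hf hf0 (n / t) (n % t)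
  rw [Nat.div_add_mod] at hn
  refine hn.trans (mul_le_mul_of_nonneg_right ?_ (integral_nonneg fun _ => sq_nonneg _))
  rw [mul_pow, Real.sq_sqrt (by positivity), ← div_eq_mul_inv, le_div_iff₀ hb0]
  nth_rewrite 2 [← hρt]
  conv_lhs => rw [← hρt]
  rw [← pow_mul, ← pow_add, ← pow_mul]
  refine pow_le_pow_of_le_one hρ0.le hρ1.le ?_
  have h1 := Nat.div_add_mod n t
  have h2 := Nat.mod_lt n ht
  nlinarith

lemma absolutelyContinuous_bind {μ : Measure Y} (hT : T.Invariant ω) (h : μ ≪ ω) :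
    μ.bind T ≪ ω := by
  refine Measure.AbsolutelyContinuous.mk fun s hs h0 => ?_
  rw [← hT.def, Measure.bind_apply hs T.aemeasurable,
    lintegral_eq_zero_iff (T.measurable_coe hs)] at h0
  rw [Measure.bind_apply hs T.aemeasurable, lintegral_eq_zero_iff (T.measurable_coe hs)]
  exact h.ae_le h0

lemma integrable_of_memLTwoStar [IsFiniteMeasure ω] {μ : Measure Y} (hμ : MemLTwoStar ω μ)
    {f : Y → ℝ} (hf : MemLp f 2 ω) : Integrable f μ := by
  obtain ⟨_, hac, hd⟩ := hμ
  exact (integrable_rnDeriv_smul_iff hac).1 (hd.integrable_mul hf)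

lemma integral_of_memLTwoStar [IsFiniteMeasure ω] {μ : Measure Y} (hμ : MemLTwoStar ω μ)
    (f : Y → ℝ) : ∫ y, (μ.rnDeriv ω y).toReal * f y ∂ω = ∫ y, f y ∂μ := by
  obtain ⟨_, hac, hd⟩ := hμ
  exact integral_rnDeriv_smul hac

lemma integral_bind_of_memLTwoStar [IsMarkovKernel T] [IsFiniteMeasure ω] (hT : T.Invariant ω)
    {μ : Measure Y} (hμ : MemLTwoStar ω μ) {f : Y → ℝ} (hf : MemLp f 2 ω) :
    ∫ y, f y ∂(μ.bind T) = ∫ y, kernelOp T f y ∂μ := by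
  have hac := absolutelyContinuous_bind hT hμ.2.1
  refine integral_bind_kernel ((Measure.integrable_comp_iff (hf.1.mono_ac hac)).2 ⟨?_, ?_⟩)
  · filter_upwards [hμ.2.1.ae_le (ae_memLp_two hT hf)] with y hy using hy.integrable one_le_two
  · exact integrable_of_memLTwoStar hμ (memLp_kernelOp hT hf.norm)

/-- A Markov kernel one of whose positive powers is a strict contraction of `L₀²(ω)` is `L²(ω)`
geometrically convergent. -/
theorem lTwoGeomConvergent_of_mtkNorm_lt_one [IsMarkovKernel T] [IsProbabilityMeasure ω]
    (hT : T.Invariant ω) {t : ℕ} (ht : 0 < t) (h : mtkNorm (kpow T t) ω < 1) :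
    LTwoGeomConvergent T ω := by
  obtain ⟨ρ, hρ0, hρ1, a, ha0, hρ⟩ := exists_integral_sq_iterate_le hT ht h
  refine ⟨ρ.toNNReal, by simpa using hρ1,
    fun μ => (a * √(∫ y, (μ.rnDeriv ω y).toReal ^ 2 ∂ω)).toNNReal, fun μ hμ n => ?_⟩
  have := hμ.1
  refine iSup_le fun f => iSup_le fun hf => iSup_le fun hf1 => ?_
  rw [← ENNReal.ofReal, ← ENNReal.ofReal, ← ENNReal.ofReal_pow hρ0.le,
    ← ENNReal.ofReal_mul (by positivity)]
  refine ENNReal.ofReal_le_ofReal ?_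
  set m := ∫ y, f y ∂ω with hm
  have hfi := hf.integrable one_le_two
  have hf2 : ∫ y, f y ^ 2 ∂ω = 1 := by
    rw [eLpNorm_two_eq hf, ENNReal.ofReal_eq_one] at hf1
    exact Real.sqrt_eq_one.1 hf1
  -- Both measures are probabilities, so constants cancel in the difference and `f` may be centred
  -- without increasing its norm.
  let g : Y → ℝ := fun y => f y - m
  have hg : MemLp g 2 ω := hf.sub (memLp_const m)
  have hg0 : ∫ y, g y ∂ω = 0 :=
    (integral_sub hfi (integrable_const m)).trans (by simp [hm])
  have hg2 : ∫ y, g y ^ 2 ∂ω ≤ 1 := by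
    have h1 := variance_eq_integral (μ := ω) hf.1.aemeasurable
    have h2 := variance_le_expectation_sq (μ := ω) hf.1
    rw [h1] at h2
    exact h2.trans_eq hf2
  have hgn := memLp_kernelOp_iterate hT hg n
  have hfn := memLp_kernelOp_iterate hT hf n
  have hgs : (kernelOp T)^[n] g =ᵐ[ω] (kernelOp T)^[n] f - (kernelOp T)^[n] fun _ => m :=
    kernelOp_iterate_sub_ae hT hf (memLp_const m) n
  have key : ∫ y, f y ∂(μ.bind (kpow T n)) - m =
      ∫ y, (μ.rnDeriv ω y).toReal * (kernelOp T)^[n] g y ∂ω := by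
    rw [integral_bind_of_memLTwoStar (invariant_kpow hT n) hμ hf, integral_of_memLTwoStar hμ,
      integral_congr_ae (hμ.2.1.ae_le (kernelOp_kpow_ae hT hf n)),
      integral_congr_ae (hμ.2.1.ae_le hgs),
      kernelOp_iterate_const]
    simp only [Pi.sub_apply]
    rw [integral_sub (integrable_of_memLTwoStar hμ hfn) (integrable_const m)]
    simp
  rw [key]
  refine (abs_integral_mul_le_sqrt hμ.2.2 hgn).trans ?_
  have h1 : √(∫ y, (kernelOp T)^[n] g y ^ 2 ∂ω) ≤ ρ ^ n * a := by
    refine Real.sqrt_le_iff.2 ⟨by positivity, (hρ _ hg hg0 n).trans ?_⟩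
    exact mul_le_of_le_one_right (by positivity) hg2
  calc _ ≤ √(∫ y, (μ.rnDeriv ω y).toReal ^ 2 ∂ω) * (ρ ^ n * a) :=
        mul_le_mul_of_nonneg_left h1 (Real.sqrt_nonneg _)
    _ = _ := by ring

end GeometricConvergence

end TransDim
namespace TransDim

/-! ### Variance under a minorized measure -/

section Minorization

variable {X Z : Type*} [MeasurableSpace X] [MeasurableSpace Z]

lemma memLp_comp_of_smul_map_le {μ : Measure X} {ν : Measure Z} {e : Z → X}
    (he : MeasurableEmbedding e) {c : ℝ} (hc : 0 < c)
    (h : ENNReal.ofReal c • ν.map e ≤ μ) {f : X → ℝ} (hf : MemLp f 2 μ) :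
    MemLp (f ∘ e) 2 ν := by
  rw [← he.memLp_map_measure_iff]
  have h1 := hf.mono_measure h
  have hc0 : ENNReal.ofReal c ≠ 0 := by simpa using hc
  have h2 := h1.smul_measure (ENNReal.inv_ne_top.2 hc0)
  rwa [smul_smul, ENNReal.inv_mul_cancel hc0 ENNReal.ofReal_ne_top, one_smul] at h2

lemma mul_integral_comp_le {μ : Measure X} {ν : Measure Z} {e : Z → X}
    (he : MeasurableEmbedding e) {c : ℝ} (hc : 0 < c)
    (h : ENNReal.ofReal c • ν.map e ≤ μ) {f : X → ℝ} (hf0 : 0 ≤ f) (hf : Integrable f μ) :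
    c * ∫ z, f (e z) ∂ν ≤ ∫ x, f x ∂μ := by
  have h1 := integral_mono_measure h (ae_of_all _ hf0) hf
  rwa [integral_smul_measure, he.integral_map, ENNReal.toReal_ofReal hc.le, smul_eq_mul] at h1

/-- A minorized measure has a mean close to that of the minorizing one, and a small variance,
whenever the latter has small variance. -/
lemma mul_sq_sub_add_variance_le {μ : Measure X} {ν : Measure Z} [IsProbabilityMeasure μ]
    [IsProbabilityMeasure ν] {e : Z → X} (he : MeasurableEmbedding e) {c : ℝ} (hc : 0 < c)
    (h : ENNReal.ofReal c • ν.map e ≤ μ) {f : X → ℝ} (hf : MemLp f 2 μ) :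
    c * ((∫ z, f (e z) ∂ν - ∫ x, f x ∂μ) ^ 2 + Var[f ∘ e; ν]) ≤ Var[f; μ] := by
  have hfe := memLp_comp_of_smul_map_le he hc h hf
  rw [variance_eq_integral hf.1.aemeasurable]
  refine le_trans (le_of_eq ?_) (mul_integral_comp_le (f := fun x => (f x - ∫ x, f x ∂μ) ^ 2) he hc h
    (fun _ => sq_nonneg _) (hf.sub (memLp_const _)).integrable_sq)
  congr 1
  -- Bias-variance decomposition under `ν` of the second moment about the `μ`-mean.
  set m := ∫ x, f x ∂μ
  have hm : MemLp (fun z => (f ∘ e) z - m) 2 ν := hfe.sub (memLp_const m)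
  have h1 := variance_eq_sub hm
  rw [variance_sub_const hfe.1, integral_sub (hfe.integrable one_le_two) (integrable_const m)] at h1
  simp only [integral_const, probReal_univ, one_smul, Pi.pow_apply, Function.comp_apply] at h1
  linarith

end Minorization

/-! ### Mixtures on a disjoint union -/

section Sigma

variable {K : Type*} {Z : K → Type*} [∀ k, MeasurableSpace (Z k)]

lemma measurableSet_sigma_iff {s : Set (Σ k, Z k)} :
    MeasurableSet s ↔ ∀ k, MeasurableSet (Sigma.mk k ⁻¹' s) := by
  rw [Sigma.instMeasurableSpace, MeasurableSpace.measurableSet_iInf]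
  rfl

lemma measurableEmbedding_sigmaMk (k : K) : MeasurableEmbedding (Sigma.mk k : Z k → Σ k, Z k) where
  injective := sigma_mk_injective
  measurable := fun _ hs => measurableSet_sigma_iff.1 hs k
  measurableSet_image' := fun s hs => by
    refine measurableSet_sigma_iff.2 fun j => ?_
    by_cases h : j = k
    · subst h
      rwa [Set.preimage_image_eq _ sigma_mk_injective]
    · rw [Set.preimage_image_sigmaMk_of_ne h]
      exact MeasurableSet.empty

lemma measurable_comp_fst (m : K → ℝ) : Measurable fun x : Σ k, Z k => m x.1 := by
  intro s _
  refine measurableSet_sigma_iff.2 fun k => ?_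
  exact MeasurableSet.const (m k ∈ s)

lemma memLp_comp_fst [Fintype K] (m : K → ℝ) (μ : Measure (Σ k, Z k)) [IsFiniteMeasure μ] :
    MemLp (fun x : Σ k, Z k => m x.1) 2 μ := by
  refine MemLp.of_bound (measurable_comp_fst m).aestronglyMeasurable (∑ k, ‖m k‖) (ae_of_all _ ?_)
  intro x
  exact Finset.single_le_sum (f := fun k => ‖m k‖) (fun _ _ => norm_nonneg _) (Finset.mem_univ x.1)

/-- The mixture `∑ k, w k • Φ k` on the disjoint union. -/
noncomputable def mixture [Fintype K] (w : K → ℝ) (Φ : ∀ k, Measure (Z k)) : Measure (Σ k, Z k) :=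
  ∑ k, ENNReal.ofReal (w k) • (Φ k).map (Sigma.mk k)

variable [Fintype K] {w : K → ℝ} {Φ : ∀ k, Measure (Z k)}

lemma smul_map_le_mixture (k : K) :
    ENNReal.ofReal (w k) • (Φ k).map (Sigma.mk k) ≤ mixture w Φ :=
  Finset.single_le_sum (f := fun k => ENNReal.ofReal (w k) • (Φ k).map (Sigma.mk k))
    (fun _ _ => Measure.zero_le _) (Finset.mem_univ k)

lemma integral_mixture (hw : ∀ k, 0 < w k) {f : (Σ k, Z k) → ℝ} (hf : Integrable f (mixture w Φ)) :
    ∫ x, f x ∂(mixture w Φ) = ∑ k, w k * ∫ z, f ⟨k, z⟩ ∂(Φ k) := by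
  rw [mixture, integral_finsetSum_measure fun k _ => hf.mono_measure (smul_map_le_mixture k)]
  refine Finset.sum_congr rfl fun k _ => ?_
  rw [integral_smul_measure, (measurableEmbedding_sigmaMk k).integral_map,
    ENNReal.toReal_ofReal (hw k).le, smul_eq_mul]

lemma memLp_slice (hw : ∀ k, 0 < w k) {f : (Σ k, Z k) → ℝ} (hf : MemLp f 2 (mixture w Φ)) (k : K) :
    MemLp (fun z => f ⟨k, z⟩) 2 (Φ k) :=
  memLp_comp_of_smul_map_le (measurableEmbedding_sigmaMk k) (hw k) (smul_map_le_mixture k) hf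

lemma ae_slice (hw : ∀ k, 0 < w k) {p : (Σ k, Z k) → Prop} (h : ∀ᵐ x ∂(mixture w Φ), p x) (k : K) :
    ∀ᵐ z ∂(Φ k), p ⟨k, z⟩ := by
  have h1 : ∀ᵐ x ∂(ENNReal.ofReal (w k) • (Φ k).map (Sigma.mk k)), p x :=
    ae_mono (smul_map_le_mixture k) h
  rw [Measure.ae_ennreal_smul_measure_iff (by simpa using hw k)] at h1
  exact (measurableEmbedding_sigmaMk k).ae_map_iff.1 h1

end Sigma

end TransDim
namespace TransDim

/-! ### From local contraction to small variance on each component -/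

section Contraction

variable {Y : Type*} [MeasurableSpace Y] {T : Kernel Y Y} {ω : Measure Y}

/-- The contraction applies to the centred function; `T^t` preserves the mean, so the squared mean
cancels in the difference of second moments. -/
lemma one_sub_mul_variance_le [IsMarkovKernel T] [IsProbabilityMeasure ω] (hT : T.Invariant ω)
    {t : ℕ} {r : ℝ}
    (hr : ∀ f : Y → ℝ, MemLp f 2 ω → ∫ y, f y ∂ω = 0 →
        ∫ y, (kernelOp T)^[t] f y ^ 2 ∂ω ≤ r * ∫ y, f y ^ 2 ∂ω)
    {f : Y → ℝ} (hf : MemLp f 2 ω) :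
    (1 - r) * Var[f; ω] ≤ ∫ y, f y ^ 2 ∂ω - ∫ y, (kernelOp T)^[t] f y ^ 2 ∂ω := by
  set m := ∫ y, f y ∂ω with hm
  let g : Y → ℝ := fun y => f y - m
  have hft := memLp_kernelOp_iterate hT hf t
  have hg : MemLp g 2 ω := hf.sub (memLp_const m)
  have hg0 : ∫ y, g y ∂ω = 0 :=
    (integral_sub (hf.integrable one_le_two) (integrable_const m)).trans (by simp [hm])
  have hgs : (kernelOp T)^[t] g =ᵐ[ω] (kernelOp T)^[t] f - (kernelOp T)^[t] fun _ => m :=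
    kernelOp_iterate_sub_ae hT hf (memLp_const m) t
  rw [kernelOp_iterate_const] at hgs
  have h1 := hr g hg hg0
  have e1 : ∫ y, g y ^ 2 ∂ω = Var[f; ω] := (variance_eq_integral hf.1.aemeasurable).symm
  have e2 : ∫ y, (kernelOp T)^[t] g y ^ 2 ∂ω = Var[(kernelOp T)^[t] f; ω] := by
    rw [variance_eq_integral hft.1.aemeasurable, integral_kernelOp_iterate hT hf]
    refine integral_congr_ae ?_
    filter_upwards [hgs] with y hy
    rw [hy]
    rfl
  have e3 := variance_eq_sub hf
  have e4 := variance_eq_sub hft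
  rw [integral_kernelOp_iterate hT hf] at e4
  simp only [Pi.pow_apply] at e3 e4
  rw [e1, e2] at h1
  linarith

end Contraction

section Components

variable {K : Type*} {Z : K → Type*} [∀ k, MeasurableSpace (Z k)]

/-- The restriction of a function on the disjoint union to the component `k`. -/
def slice (f : (Σ k, Z k) → ℝ) (k : K) : Z k → ℝ := fun z => f ⟨k, z⟩

variable [Fintype K] {w : K → ℝ} {Φ : ∀ k, Measure (Z k)}

instance isFiniteMeasure_mixture [∀ k, IsFiniteMeasure (Φ k)] : IsFiniteMeasure (mixture w Φ) := by
  have (k : K) : IsFiniteMeasure (ENNReal.ofReal (w k) • (Φ k).map (Sigma.mk k)) :=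
    Measure.smul_finite _ ENNReal.ofReal_ne_top
  unfold mixture
  infer_instance

lemma mul_integral_slice_le (hw : ∀ k, 0 < w k) {f : (Σ k, Z k) → ℝ} (hf0 : 0 ≤ f)
    (hf : Integrable f (mixture w Φ)) (k : K) :
    w k * ∫ z, f ⟨k, z⟩ ∂(Φ k) ≤ ∫ x, f x ∂(mixture w Φ) :=
  mul_integral_comp_le (measurableEmbedding_sigmaMk k) (hw k) (smul_map_le_mixture k) hf0 hf

lemma integrable_slice (hw : ∀ k, 0 < w k) {f : (Σ k, Z k) → ℝ} (hf : Integrable f (mixture w Φ))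
    (k : K) : Integrable (fun z => f ⟨k, z⟩) (Φ k) := by
  have h := hf.mono_measure (smul_map_le_mixture (w := w) (Φ := Φ) k)
  rw [integrable_smul_measure (by simpa using hw k) ENNReal.ofReal_ne_top,
    (measurableEmbedding_sigmaMk k).integrable_map_iff] at h
  exact h

lemma mul_integral_variance_le_dirichlet [∀ k, IsProbabilityMeasure (Φ k)] (hw : ∀ k, 0 < w k)
    {P : Kernel (Σ k, Z k) (Σ k, Z k)} [IsMarkovKernel P] (hP : P.Invariant (mixture w Φ))
    {f : (Σ k, Z k) → ℝ} (hf : MemLp f 2 (mixture w Φ)) (k : K) :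
    w k * ∫ z, Var[f; P ⟨k, z⟩] ∂(Φ k) ≤ dirichlet P (mixture w Φ) f :=
  mul_integral_slice_le (f := fun x => Var[f; P x]) hw
    (fun _ => variance_nonneg _ _) (integrable_variance hP hf) k

variable [∀ k, IsProbabilityMeasure (Φ k)] (hw : ∀ k, 0 < w k)
  {P : Kernel (Σ k, Z k) (Σ k, Z k)} [IsMarkovKernel P] (hP : P.Invariant (mixture w Φ))
  {k : K} {Q : Kernel (Z k) (Z k)} [IsMarkovKernel Q] (hQ : Q.Invariant (Φ k)) {c : ℝ} (hc : 0 < c)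
  (hmin : ∀ z, ENNReal.ofReal c • (Q z).map (Sigma.mk k) ≤ P ⟨k, z⟩)

include hw hP hQ hc hmin

lemma mul_sq_sub_add_dirichlet_le {f : (Σ k, Z k) → ℝ} (hf : MemLp f 2 (mixture w Φ)) :
    w k * c * (∫ z, (kernelOp Q (slice f k) z - slice (kernelOp P f) k z) ^ 2 ∂(Φ k) +
      dirichlet Q (Φ k) (slice f k)) ≤ dirichlet P (mixture w Φ) f := by
  have hs : MemLp (slice f k) 2 (Φ k) := memLp_slice hw hf k
  have hd : MemLp (fun z => kernelOp Q (slice f k) z - slice (kernelOp P f) k z) 2 (Φ k) :=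
    (memLp_kernelOp hQ hs).sub (memLp_slice hw (memLp_kernelOp hP hf) k)
  refine le_trans ?_ (mul_integral_variance_le_dirichlet hw hP hf k)
  have hi : Integrable (fun z => Var[f; P ⟨k, z⟩]) (Φ k) :=
    integrable_slice hw (integrable_variance hP hf) k
  rw [mul_assoc, dirichlet, ← integral_add hd.integrable_sq (integrable_variance hQ hs),
    ← integral_const_mul]
  refine mul_le_mul_of_nonneg_left (integral_mono_ae
    ((hd.integrable_sq.add (integrable_variance hQ hs)).const_mul c) hi ?_) (hw k).le
  filter_upwards [ae_slice hw (ae_memLp_two hP hf) k] with z hz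
  exact mul_sq_sub_add_variance_le (measurableEmbedding_sigmaMk k) hc (hmin z) hz

/-- Induction on `Q^(n+1) f - P^(n+1) f = Q (Q^n f - P^n f) + (Q - P) P^n f` on the component: `Q`
does not increase the first term, and the energy of `P^n f` controls the second. -/
lemma exists_integral_iterate_sub_sq_le (n : ℕ) : ∃ C : ℝ, ∀ f : (Σ k, Z k) → ℝ,
    MemLp f 2 (mixture w Φ) → ∀ δ : ℝ,
    (∀ i < n, dirichlet P (mixture w Φ) ((kernelOp P)^[i] f) ≤ δ) →
    ∫ z, ((kernelOp Q)^[n] (slice f k) z - slice ((kernelOp P)^[n] f) k z) ^ 2 ∂(Φ k) ≤ C * δ := by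
  induction n with
  | zero => exact ⟨0, fun f _ δ _ => by simp⟩
  | succ n ih =>
    obtain ⟨C, hC⟩ := ih
    refine ⟨2 * C + 2 * (w k * c)⁻¹, fun f hf δ hδ => ?_⟩
    have h1 := hC f hf δ fun i hi => hδ i (hi.trans n.lt_succ_self)
    have hs : MemLp (slice f k) 2 (Φ k) := memLp_slice hw hf k
    have hPn := memLp_kernelOp_iterate hP hf n
    have hQn := memLp_kernelOp_iterate hQ hs n
    have hsn : MemLp (slice ((kernelOp P)^[n] f) k) 2 (Φ k) := memLp_slice hw hPn k
    have h2 := integral_sq_kernelOp_le hQ (hQn.sub hsn)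
    have h3 := mul_sq_sub_add_dirichlet_le hw hP hQ hc hmin hPn
    have h4 := hδ n n.lt_succ_self
    have h5 := dirichlet_nonneg (T := Q) (ω := Φ k) (slice ((kernelOp P)^[n] f) k)
    have hwc : 0 < w k * c := mul_pos (hw k) hc
    have h6 : ∫ z, (kernelOp Q (slice ((kernelOp P)^[n] f) k) z -
        slice (kernelOp P ((kernelOp P)^[n] f)) k z) ^ 2 ∂(Φ k) ≤ (w k * c)⁻¹ * δ := by
      rw [inv_mul_eq_div, le_div_iff₀ hwc]
      nlinarith
    have hd : MemLp (fun z => kernelOp Q (slice ((kernelOp P)^[n] f) k) z -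
        slice (kernelOp P ((kernelOp P)^[n] f)) k z) 2 (Φ k) :=
      (memLp_kernelOp hQ hsn).sub (memLp_slice hw (memLp_kernelOp hP hPn) k)
    have h7 := integral_add_sq_le (memLp_kernelOp hQ (hQn.sub hsn)) hd
    rw [Function.iterate_succ_apply', Function.iterate_succ_apply']
    have h8 : ∫ z, (kernelOp Q ((kernelOp Q)^[n] (slice f k)) z -
        slice (kernelOp P ((kernelOp P)^[n] f)) k z) ^ 2 ∂(Φ k) =
        ∫ z, (kernelOp Q ((kernelOp Q)^[n] (slice f k) - slice ((kernelOp P)^[n] f) k) z +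
          (kernelOp Q (slice ((kernelOp P)^[n] f) k) z -
            slice (kernelOp P ((kernelOp P)^[n] f)) k z)) ^ 2 ∂(Φ k) := by
      refine integral_congr_ae ?_
      filter_upwards [kernelOp_sub_ae hQ hQn hsn] with z hz
      rw [hz, Pi.sub_apply]
      ring
    rw [h8]
    have h9 : ∫ z, ((kernelOp Q)^[n] (slice f k) - slice ((kernelOp P)^[n] f) k) z ^ 2 ∂(Φ k) ≤
        C * δ := h1
    linarith

/-- The loss telescopes into the `Q`-energies of `Q^n f`. Each is compared with the `Q`-energy of
`P^n f` at the cost of their squared distance, and both are `O(δ)`. -/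
lemma exists_integral_sq_sub_iterate_le (n : ℕ) : ∃ C : ℝ, ∀ f : (Σ k, Z k) → ℝ,
    MemLp f 2 (mixture w Φ) → ∀ δ : ℝ,
    (∀ i < n, dirichlet P (mixture w Φ) ((kernelOp P)^[i] f) ≤ δ) →
    ∫ z, slice f k z ^ 2 ∂(Φ k) - ∫ z, (kernelOp Q)^[n] (slice f k) z ^ 2 ∂(Φ k) ≤ C * δ := by
  induction n with
  | zero => exact ⟨0, fun f _ δ _ => by simp⟩
  | succ n ih =>
    obtain ⟨C, hC⟩ := ih
    obtain ⟨B, hB⟩ := exists_integral_iterate_sub_sq_le hw hP hQ hc hmin n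
    refine ⟨C + (2 * (w k * c)⁻¹ + 2 * B), fun f hf δ hδ => ?_⟩
    have hδ' := fun i (hi : i < n) => hδ i (hi.trans n.lt_succ_self)
    have h1 := hC f hf δ hδ'
    have hs : MemLp (slice f k) 2 (Φ k) := memLp_slice hw hf k
    have hPn := memLp_kernelOp_iterate hP hf n
    have hQn := memLp_kernelOp_iterate hQ hs n
    have hsn : MemLp (slice ((kernelOp P)^[n] f) k) 2 (Φ k) := memLp_slice hw hPn k
    have h2 := dirichlet_le_two_mul_add hQ hQn hsn
    have h3 := mul_sq_sub_add_dirichlet_le hw hP hQ hc hmin hPn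
    have h4 := hδ n n.lt_succ_self
    have hwc : 0 < w k * c := mul_pos (hw k) hc
    have h6 : dirichlet Q (Φ k) (slice ((kernelOp P)^[n] f) k) ≤ (w k * c)⁻¹ * δ := by
      have h5 : 0 ≤ ∫ z, (kernelOp Q (slice ((kernelOp P)^[n] f) k) z -
        slice (kernelOp P ((kernelOp P)^[n] f)) k z) ^ 2 ∂(Φ k) :=
        integral_nonneg fun _ => sq_nonneg _
      rw [inv_mul_eq_div, le_div_iff₀ hwc]
      nlinarith
    have h7 := hB f hf δ hδ'
    rw [dirichlet_eq hQ hQn, ← Function.iterate_succ_apply' (kernelOp Q)] at h2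
    linarith

lemma exists_variance_slice_le {t : ℕ} (hnorm : mtkNorm (kpow Q t) (Φ k) < 1) :
    ∃ C : ℝ, 0 ≤ C ∧ ∀ f : (Σ k, Z k) → ℝ, MemLp f 2 (mixture w Φ) → ∀ δ : ℝ, 0 ≤ δ →
    (∀ i < t, dirichlet P (mixture w Φ) ((kernelOp P)^[i] f) ≤ δ) →
    Var[slice f k; Φ k] ≤ C * δ := by
  obtain ⟨r, _, hr1, hr⟩ := (mtkNorm_kpow_lt_one_iff hQ t).1 hnorm
  obtain ⟨C, hC⟩ := exists_integral_sq_sub_iterate_le hw hP hQ hc hmin t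
  have h1r : 0 < 1 - r := by linarith
  refine ⟨(1 - r)⁻¹ * |C|, by positivity, fun f hf δ hδ0 hδ => ?_⟩
  have h1 := one_sub_mul_variance_le hQ hr (memLp_slice hw hf k)
  have h2 := hC f hf δ hδ
  have h3 : C * δ ≤ |C| * δ := mul_le_mul_of_nonneg_right (le_abs_self C) hδ0
  rw [mul_assoc, inv_mul_eq_div, le_div_iff₀ h1r, mul_comm]
  exact h1.trans (h2.trans h3)

end Components

end TransDim
namespace TransDim

/-! ### Comparison of the component means, and the global contraction -/

/-- A positive entry of `M^n` encodes a path of length `n`; the bound is chained along it by `(a +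
b)² ≤ 2 a² + 2 b²`. -/
lemma exists_sq_sub_le_of_pow_pos {K : Type*} [Fintype K] [DecidableEq K] (M : Matrix K K ℕ)
    {E : (K → ℝ) → ℝ}
    (hE : ∀ k k', 0 < M k k' → ∃ C : ℝ, 0 ≤ C ∧ ∀ m : K → ℝ, (m k - m k') ^ 2 ≤ C * E m) (n : ℕ) :
    ∀ k k', 0 < (M ^ n) k k' → ∃ C : ℝ, 0 ≤ C ∧ ∀ m : K → ℝ, (m k - m k') ^ 2 ≤ C * E m := by
  induction n with
  | zero =>
    intro k k' h
    have hk : k = k' := by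
      by_contra hne
      simp [Matrix.one_apply_ne hne] at h
    subst hk
    exact ⟨0, le_rfl, fun m => by simp⟩
  | succ n ih =>
    intro k k' h
    rw [pow_succ, Matrix.mul_apply] at h
    obtain ⟨j, _, hj⟩ := Finset.exists_ne_zero_of_sum_ne_zero h.ne'
    obtain ⟨C₁, h₁, H₁⟩ := ih k j (Nat.pos_of_ne_zero (left_ne_zero_of_mul hj))
    obtain ⟨C₂, h₂, H₂⟩ := hE j k' (Nat.pos_of_ne_zero (right_ne_zero_of_mul hj))
    refine ⟨2 * C₁ + 2 * C₂, by positivity, fun m => ?_⟩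
    have e₁ := H₁ m
    have e₂ := H₂ m
    nlinarith [sq_nonneg ((m k - m j) - (m j - m k'))]

lemma sq_le_sum_mul_sq_sub {K : Type*} [Fintype K] {w m : K → ℝ} (hw0 : ∀ k, 0 ≤ w k)
    (hw : ∑ k, w k = 1) (hm : ∑ k, w k * m k = 0) (k : K) :
    m k ^ 2 ≤ ∑ j, w j * (m k - m j) ^ 2 := by
  have h : ∑ j, w j * (m k - m j) ^ 2 =
      m k ^ 2 * ∑ j, w j - 2 * m k * ∑ j, w j * m j + ∑ j, w j * m j ^ 2 := by
    rw [Finset.mul_sum, Finset.mul_sum, ← Finset.sum_sub_distrib, ← Finset.sum_add_distrib]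
    exact Finset.sum_congr rfl fun j _ => by ring
  rw [h, hw, hm]
  have : 0 ≤ ∑ j, w j * m j ^ 2 :=
    Finset.sum_nonneg fun j _ => mul_nonneg (hw0 j) (sq_nonneg _)
  linarith

section Components

variable {K : Type*} {Z : K → Type*} [∀ k, MeasurableSpace (Z k)]

lemma measurableSet_component (k : K) :
    MeasurableSet (Sigma.mk k '' Set.univ : Set (Σ k, Z k)) :=
  (measurableEmbedding_sigmaMk k).measurableSet_image' MeasurableSet.univ

variable [Fintype K]

/-- Two disjoint components of masses `p ≥ c` and `p'` contribute `p (m k - a)² + p' (m k' - a)²` to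
the variance, and `c p'` is at most both masses. A lower bound on staying is essential: a sure jump
has variance zero. -/
lemma mul_real_mul_sq_sub_le_variance {μ : Measure (Σ k, Z k)} [IsProbabilityMeasure μ] {c : ℝ}
    {k k' : K} (hc : 0 ≤ c) (hck : c ≤ μ.real (Sigma.mk k '' Set.univ)) (m : K → ℝ) :
    c * μ.real (Sigma.mk k' '' Set.univ) * (m k - m k') ^ 2 ≤ 2 * Var[fun x => m x.1; μ] := by
  by_cases hkk : k = k'
  · subst hkk
    simp [variance_nonneg]
  have hF := memLp_comp_fst m μ
  rw [variance_eq_integral hF.1.aemeasurable]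
  set a := ∫ x, m x.1 ∂μ
  set S : K → Set (Σ k, Z k) := fun k => Sigma.mk k '' Set.univ
  have hint (j : K) : Integrable ((S j).indicator fun _ => (m j - a) ^ 2) μ :=
    (integrable_const _).indicator (measurableSet_component j)
  have h1 : ∫ x, (S k).indicator (fun _ => (m k - a) ^ 2) x +
      (S k').indicator (fun _ => (m k' - a) ^ 2) x ∂μ ≤ ∫ x, (m x.1 - a) ^ 2 ∂μ := by
    refine integral_mono ((hint k).add (hint k')) (hF.sub (memLp_const a)).integrable_sq ?_
    rintro ⟨j, z⟩
    simp only [S, Set.image_univ, Set.range_sigmaMk]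
    by_cases h : j = k
    · subst h
      simp [hkk]
    · by_cases h' : j = k'
      · subst h'
        simp [h]
      · simp [h, h', sq_nonneg]
  rw [integral_add (hint k) (hint k'), integral_indicator_const _ (measurableSet_component k),
    integral_indicator_const _ (measurableSet_component k'), smul_eq_mul, smul_eq_mul] at h1
  have h2 : μ.real (S k) ≤ 1 := measureReal_le_one
  have h3 : μ.real (S k') ≤ 1 := measureReal_le_one
  have h4 : 0 ≤ μ.real (S k') := measureReal_nonneg
  have h5 : c * μ.real (S k') ≤ μ.real (S k) := (mul_le_of_le_one_right hc h3).trans hck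
  have h6 : c * μ.real (S k') ≤ μ.real (S k') := mul_le_of_le_one_left h4 (hck.trans h2)
  have h7 := mul_le_mul_of_nonneg_right h5 (sq_nonneg (m k - a))
  have h8 := mul_le_mul_of_nonneg_right h6 (sq_nonneg (m k' - a))
  have h9 : (m k - m k') ^ 2 ≤ 2 * (m k - a) ^ 2 + 2 * (m k' - a) ^ 2 := by
    nlinarith [sq_nonneg ((m k - a) + (m k' - a))]
  have h10 := mul_le_mul_of_nonneg_left h9 (mul_nonneg hc h4)
  change c * μ.real (S k') * (m k - m k') ^ 2 ≤ _
  linarith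

variable {w : K → ℝ} {Φ : ∀ k, Measure (Z k)} [∀ k, IsProbabilityMeasure (Φ k)]
  {P : Kernel (Σ k, Z k) (Σ k, Z k)} [IsMarkovKernel P]

lemma exists_sq_sub_le_dirichlet (hw : ∀ k, 0 < w k) (hP : P.Invariant (mixture w Φ)) {k k' : K}
    {c : ℝ} (hc : 0 < c) (hck : ∀ z, c ≤ (P ⟨k, z⟩).real (Sigma.mk k '' Set.univ))
    (hpos : 0 < ∫⁻ z, P ⟨k, z⟩ (Sigma.mk k' '' Set.univ) ∂(Φ k)) :
    ∃ C : ℝ, 0 ≤ C ∧ ∀ m : K → ℝ,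
      (m k - m k') ^ 2 ≤ C * dirichlet P (mixture w Φ) fun x => m x.1 := by
  set S : Set (Σ k, Z k) := Sigma.mk k' '' Set.univ
  have hmeas : Measurable fun z => P ⟨k, z⟩ S :=
    (P.measurable_coe (measurableSet_component k')).comp (measurableEmbedding_sigmaMk k).measurable
  have hlt : ∫⁻ z, P ⟨k, z⟩ S ∂(Φ k) < ∞ := by
    refine lt_of_le_of_lt (lintegral_mono fun z => prob_le_one) ?_
    simp
  have hq : 0 < ∫ z, (P ⟨k, z⟩).real S ∂(Φ k) := by
    simp only [measureReal_def]
    rw [integral_toReal hmeas.aemeasurable (ae_of_all _ fun z => measure_lt_top _ _)]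
    exact ENNReal.toReal_pos hpos.ne' hlt.ne
  have hqi : Integrable (fun z => (P ⟨k, z⟩).real S) (Φ k) :=
    Integrable.of_bound hmeas.ennreal_toReal.aestronglyMeasurable 1 (ae_of_all _ fun z => by
      rw [Real.norm_of_nonneg measureReal_nonneg]
      exact measureReal_le_one)
  set q := ∫ z, (P ⟨k, z⟩).real S ∂(Φ k)
  have hwk := hw k
  refine ⟨2 / (w k * (c * q)), by positivity, fun m => ?_⟩
  have hF := memLp_comp_fst m (mixture w Φ)
  have h1 := mul_integral_variance_le_dirichlet hw hP hF k
  have hi : Integrable (fun z => Var[fun x => m x.1; P ⟨k, z⟩]) (Φ k) :=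
    integrable_slice hw (integrable_variance hP hF) k
  have h2 : ∫ z, c * (P ⟨k, z⟩).real S * (m k - m k') ^ 2 ∂(Φ k) ≤
      ∫ z, 2 * Var[fun x => m x.1; P ⟨k, z⟩] ∂(Φ k) :=
    integral_mono ((hqi.const_mul c).mul_const _) (hi.const_mul 2) fun z =>
      mul_real_mul_sq_sub_le_variance hc.le (hck z) m
  rw [integral_mul_const, integral_const_mul, integral_const_mul] at h2
  rw [div_mul_eq_mul_div, le_div_iff₀ (by positivity)]
  have h3 := mul_le_mul_of_nonneg_left h2 hwk.le
  linarith

/-- The Poincaré-type inequality for the disjoint union, from local contraction on the components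
and irreducibility of the transitions between components. -/
theorem exists_integral_sq_le [DecidableEq K] (hw : ∀ k, 0 < w k) (hw1 : ∑ k, w k = 1)
    (hP : P.Invariant (mixture w Φ)) {Q : ∀ k, Kernel (Z k) (Z k)} [∀ k, IsMarkovKernel (Q k)]
    (hQ : ∀ k, (Q k).Invariant (Φ k)) {c : K → ℝ} (hc : ∀ k, 0 < c k)
    (hmin : ∀ k z, ENNReal.ofReal (c k) • (Q k z).map (Sigma.mk k) ≤ P ⟨k, z⟩)
    {τ : K → ℕ} (hnorm : ∀ k, mtkNorm (kpow (Q k) (τ k)) (Φ k) < 1)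
    (M : Matrix K K ℕ)
    (hM : ∀ k k', 0 < M k k' → 0 < ∫⁻ z, P ⟨k, z⟩ (Sigma.mk k' '' Set.univ) ∂(Φ k))
    {s : ℕ} (hs : ∀ k k', 0 < (M ^ s) k k') {t : ℕ} (ht0 : 0 < t) (ht : ∀ k, τ k ≤ t) :
    ∃ C : ℝ, 0 ≤ C ∧ ∀ f : (Σ k, Z k) → ℝ, MemLp f 2 (mixture w Φ) →
      ∫ x, f x ∂(mixture w Φ) = 0 → ∀ δ : ℝ, 0 ≤ δ →
      (∀ i < t, dirichlet P (mixture w Φ) ((kernelOp P)^[i] f) ≤ δ) →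
      ∫ x, f x ^ 2 ∂(mixture w Φ) ≤ C * δ := by
  choose A hA0 hA using fun k => exists_variance_slice_le hw hP (hQ k) (hc k) (hmin k) (hnorm k)
  have hck (k : K) (z : Z k) : c k ≤ (P ⟨k, z⟩).real (Sigma.mk k '' Set.univ) := by
    have h1 := hmin k z (Sigma.mk k '' Set.univ)
    rw [Measure.smul_apply, (measurableEmbedding_sigmaMk k).map_apply,
      Set.preimage_image_eq _ sigma_mk_injective, measure_univ, smul_eq_mul, mul_one] at h1
    exact (ENNReal.ofReal_le_iff_le_toReal (measure_ne_top _ _)).1 h1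
  choose B hB0 hB using fun k k' => exists_sq_sub_le_of_pow_pos M
    (E := fun m => dirichlet P (mixture w Φ) fun x => m x.1)
    (fun k k' h => exists_sq_sub_le_dirichlet hw hP (hc k) (hck k) (hM k k' h)) s k k' (hs k k')
  set A' := ∑ k, A k
  set B' := ∑ k, ∑ k', B k k'
  have hA' : 0 ≤ A' := Finset.sum_nonneg fun k _ => hA0 k
  have hB' : 0 ≤ B' := Finset.sum_nonneg fun k _ => Finset.sum_nonneg fun k' _ => hB0 k k'
  have hAA (k : K) : A k ≤ A' := Finset.single_le_sum (fun j _ => hA0 j) (Finset.mem_univ k)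
  have hBB (k k' : K) : B k k' ≤ B' :=
    (Finset.single_le_sum (fun j _ => hB0 k j) (Finset.mem_univ k')).trans
      (Finset.single_le_sum (f := fun k => ∑ k', B k k')
        (fun i _ => Finset.sum_nonneg fun j _ => hB0 i j) (Finset.mem_univ k))
  -- `A'` bounds the variances within components, `2 + 2 * A'` the energy of the means, and `B'`
  -- converts that energy into squared means.
  refine ⟨A' + B' * (2 + 2 * A'), by positivity, fun f hf hf0 δ hδ0 hδ => ?_⟩
  let m : K → ℝ := fun k => ∫ z, f ⟨k, z⟩ ∂(Φ k)
  have hV (k : K) : Var[slice f k; Φ k] ≤ A' * δ :=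
    (hA k f hf δ hδ0 fun i hi => hδ i (hi.trans_le (ht k))).trans
      (mul_le_mul_of_nonneg_right (hAA k) hδ0)
  have hmean (u : ℝ) : ∑ k, w k * u = u := by rw [← Finset.sum_mul, hw1, one_mul]
  have hF := memLp_comp_fst m (mixture w Φ)
  have hFf : ∫ x, (m x.1 - f x) ^ 2 ∂(mixture w Φ) ≤ A' * δ := by
    have hi : Integrable (fun x => (m x.1 - f x) ^ 2) (mixture w Φ) := (hF.sub hf).integrable_sq
    rw [integral_mixture hw hi, ← hmean (A' * δ)]
    refine Finset.sum_le_sum fun k _ => mul_le_mul_of_nonneg_left ?_ (hw k).le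
    refine le_trans (le_of_eq ?_) (hV k)
    have hs : MemLp (slice f k) 2 (Φ k) := memLp_slice hw hf k
    rw [variance_eq_integral hs.1.aemeasurable]
    refine integral_congr_ae (ae_of_all _ fun z => ?_)
    exact sub_sq_comm _ _
  have hD : dirichlet P (mixture w Φ) (fun x => m x.1) ≤ (2 + 2 * A') * δ := by
    have h1 := dirichlet_le_two_mul_add hP hF hf
    have h2 : dirichlet P (mixture w Φ) f ≤ δ := hδ 0 ht0
    linarith
  have hm0 : ∑ k, w k * m k = 0 := by
    rw [← hf0, integral_mixture hw (hf.integrable one_le_two)]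
  have hmk (k : K) : m k ^ 2 ≤ B' * ((2 + 2 * A') * δ) := by
    refine (sq_le_sum_mul_sq_sub (fun k => (hw k).le) hw1 hm0 k).trans ?_
    rw [← hmean (B' * ((2 + 2 * A') * δ))]
    refine Finset.sum_le_sum fun j _ => mul_le_mul_of_nonneg_left ?_ (hw j).le
    exact (hB k j m).trans (mul_le_mul (hBB k j) hD (dirichlet_nonneg _) hB')
  rw [integral_mixture hw hf.integrable_sq, ← hmean ((A' + B' * (2 + 2 * A')) * δ)]
  refine Finset.sum_le_sum fun k _ => mul_le_mul_of_nonneg_left ?_ (hw k).le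
  have h1 := variance_eq_sub (memLp_slice hw hf k)
  simp only [Pi.pow_apply] at h1
  have h2 : Var[fun z => f ⟨k, z⟩; Φ k] ≤ A' * δ := hV k
  have h3 : (∫ z, f ⟨k, z⟩ ∂(Φ k)) ^ 2 ≤ B' * ((2 + 2 * A') * δ) := hmk k
  linarith

lemma mtkNorm_kpow_mixture_lt_one [DecidableEq K] (hw : ∀ k, 0 < w k) (hw1 : ∑ k, w k = 1)
    (hP : P.Invariant (mixture w Φ)) {Q : ∀ k, Kernel (Z k) (Z k)} [∀ k, IsMarkovKernel (Q k)]
    (hQ : ∀ k, (Q k).Invariant (Φ k)) {c : K → ℝ} (hc : ∀ k, 0 < c k)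
    (hmin : ∀ k z, ENNReal.ofReal (c k) • (Q k z).map (Sigma.mk k) ≤ P ⟨k, z⟩)
    {τ : K → ℕ} (hnorm : ∀ k, mtkNorm (kpow (Q k) (τ k)) (Φ k) < 1)
    (M : Matrix K K ℕ)
    (hM : ∀ k k', 0 < M k k' → 0 < ∫⁻ z, P ⟨k, z⟩ (Sigma.mk k' '' Set.univ) ∂(Φ k))
    {s : ℕ} (hs : ∀ k k', 0 < (M ^ s) k k') {t : ℕ} (ht0 : 0 < t) (ht : ∀ k, τ k ≤ t) :
    mtkNorm (kpow P t) (mixture w Φ) < 1 := by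
  obtain ⟨C, hC0, hC⟩ := exists_integral_sq_le hw hw1 hP hQ hc hmin hnorm M hM hs ht0 ht
  -- `C` may be zero; `C + 1` can be inverted and gives a rate in `[0, 1)`.
  have hC1 : 0 < C + 1 := by positivity
  refine (mtkNorm_kpow_lt_one_iff hP t).2 ⟨1 - (C + 1)⁻¹, ?_, by simpa using hC1, ?_⟩
  · exact sub_nonneg.2 (inv_le_one_of_one_le₀ (by linarith))
  · intro f hf hf0
    have hδ := antitone_integral_sq_iterate hP hf (Nat.zero_le t)
    have h1 := hC f hf hf0 _ (sub_nonneg.2 hδ) fun i hi => dirichlet_iterate_le hP hf hi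
    simp only [Function.iterate_zero, id] at h1 hδ
    have h2 : (C + 1)⁻¹ * ∫ x, f x ^ 2 ∂(mixture w Φ) ≤
        ∫ x, f x ^ 2 ∂(mixture w Φ) - ∫ x, (kernelOp P)^[t] f x ^ 2 ∂(mixture w Φ) := by
      rw [inv_mul_eq_div, div_le_iff₀ hC1]
      linarith
    linarith

end Components

/-! ### The target as a mixture of normalized measures -/

section Target

lemma isProbabilityMeasure_normalized {Y : Type*} [MeasurableSpace Y] {Ψ : Measure Y}
    [IsFiniteMeasure Ψ] (hΨ : Ψ ≠ 0) : IsProbabilityMeasure (normalized Ψ) := by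
  refine ⟨?_⟩
  rw [normalized, Measure.smul_apply, smul_eq_mul]
  exact ENNReal.inv_mul_cancel (by simpa using hΨ) (measure_ne_top _ _)

lemma lintegral_pos_of_modelMatrix_pos {K : Type*} {Z : K → Type*}
    [∀ k, MeasurableSpace (Z k)] {Ψ : ∀ k, Measure (Z k)}
    {P : Kernel (Σ k, Z k) (Σ k, Z k)} {k k' : K}
    (h : 0 < modelMatrix Ψ P k k') : 0 < ∫⁻ z, P ⟨k, z⟩ (Sigma.mk k' '' Set.univ) ∂(Ψ k) := by
  by_contra hn
  rw [modelMatrix, Matrix.of_apply, if_neg hn] at h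
  exact lt_irrefl 0 h

variable {K : Type*} [Fintype K] {Z : K → Type*} [∀ k, MeasurableSpace (Z k)]
  {Ψ : ∀ k, Measure (Z k)} [∀ k, IsFiniteMeasure (Ψ k)]

lemma real_univ_pos {Y : Type*} [MeasurableSpace Y] {Ψ : Measure Y} [IsFiniteMeasure Ψ]
    (hΨ : Ψ ≠ 0) : 0 < Ψ.real Set.univ :=
  ENNReal.toReal_pos (by simpa using hΨ) (measure_ne_top _ _)

lemma sum_real_univ_pos [Nonempty K] (hΨ : ∀ k, Ψ k ≠ 0) : 0 < ∑ k, (Ψ k).real Set.univ :=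
  Finset.sum_pos (fun k _ => real_univ_pos (hΨ k)) Finset.univ_nonempty

lemma target_eq_mixture [Nonempty K] (hΨ : ∀ k, Ψ k ≠ 0) :
    target Ψ = mixture (fun k => (Ψ k).real Set.univ / ∑ j, (Ψ j).real Set.univ)
      fun k => normalized (Ψ k) := by
  have hS := sum_real_univ_pos hΨ
  have e (k : K) : ENNReal.ofReal ((Ψ k).real Set.univ) = Ψ k Set.univ := ofReal_measureReal
  rw [target, mixture, Finset.smul_sum]
  refine Finset.sum_congr rfl fun k _ => ?_
  rw [normalized, Measure.map_smul, smul_smul, ENNReal.ofReal_div_of_pos hS, e,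
    ENNReal.ofReal_sum_of_nonneg fun _ _ => measureReal_nonneg]
  simp only [e]
  rw [div_eq_mul_inv, mul_right_comm, ENNReal.mul_inv_cancel (by simpa using hΨ k)
    (measure_ne_top _ _), one_mul]

lemma isProbabilityMeasure_target [Nonempty K] (hΨ : ∀ k, Ψ k ≠ 0) :
    IsProbabilityMeasure (target Ψ) := by
  refine ⟨?_⟩
  rw [target, Measure.smul_apply, Measure.finsetSum_apply]
  simp only [(measurableEmbedding_sigmaMk _).map_apply, Set.preimage_univ, smul_eq_mul]
  refine ENNReal.inv_mul_cancel ?_ ?_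
  · obtain ⟨k⟩ := ‹Nonempty K›
    intro h0
    exact hΨ k (Measure.measure_univ_eq_zero.1 (Finset.sum_eq_zero_iff.1 h0 k (Finset.mem_univ k)))
  · exact ENNReal.sum_ne_top.2 fun k _ => measure_ne_top _ _

lemma lintegral_normalized_pos {Y : Type*} [MeasurableSpace Y] {Φ : Measure Y}
    [IsFiniteMeasure Φ] {g : Y → ℝ≥0∞} (hg : 0 < ∫⁻ y, g y ∂Φ) :
    0 < ∫⁻ y, g y ∂(normalized Φ) := by
  rw [normalized, lintegral_smul_measure, smul_eq_mul]
  exact ENNReal.mul_pos (ENNReal.inv_ne_zero.2 (measure_ne_top _ _)) hg.ne'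

lemma smul_map_le_of_real_le {X Y : Type*} [MeasurableSpace X] [MeasurableSpace Y] {μ : Measure X}
    {ν : Measure Y} [IsFiniteMeasure μ] [IsFiniteMeasure ν] {e : Y → X}
    (he : MeasurableEmbedding e) {c : ℝ} (hc : 0 ≤ c)
    (h : ∀ A, MeasurableSet A → c * ν.real A ≤ μ.real (e '' A)) :
    ENNReal.ofReal c • ν.map e ≤ μ := by
  refine Measure.le_iff.2 fun B hB => ?_
  rw [Measure.smul_apply, he.map_apply, smul_eq_mul]
  have h1 := h (e ⁻¹' B) (he.measurable hB)
  rw [← ofReal_measureReal (μ := ν), ← ENNReal.ofReal_mul hc]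
  refine (ENNReal.ofReal_le_ofReal h1).trans ?_
  rw [ofReal_measureReal]
  exact measure_mono (Set.image_preimage_subset e B)

end Target

end TransDim

theorem theorem1
    {K : Type*} [Fintype K] [DecidableEq K] [Nonempty K]
    {Z : K → Type*} [∀ k, MeasurableSpace (Z k)]
    (Ψ : ∀ k, Measure (Z k)) [∀ k, IsFiniteMeasure (Ψ k)] (hΨ : ∀ k, Ψ k ≠ 0)
    -- the trans-dimensional kernel, with stationary distribution `Π`
    (P : Kernel (Σ k, Z k) (Σ k, Z k)) [IsMarkovKernel P]
    (hP : P.Invariant (TransDim.target Ψ))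
    -- (H1)
    (Pk : ∀ k, Kernel (Z k) (Z k)) [∀ k, IsMarkovKernel (Pk k)]
    (hinv : ∀ k, (Pk k).Invariant (TransDim.normalized (Ψ k)))
    (τ : K → ℕ) (hτ : ∀ k, 0 < τ k)
    (hnorm : ∀ k,
      TransDim.mtkNorm (TransDim.kpow (Pk k) (τ k)) (TransDim.normalized (Ψ k)) < 1)
    (c : K → ℝ) (hc : ∀ k, 0 < c k)
    (hmin : ∀ (k : K) (z : Z k) (A : Set (Z k)), MeasurableSet A →
      c k * (Pk k z).real A ≤ (P ⟨k, z⟩).real (Sigma.mk k '' A))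
    -- (H2)
    (hΓ : ∃ s : ℕ, 0 < s ∧ ∀ k k', 0 < (TransDim.modelMatrix Ψ P ^ s) k k') :
    (∀ t : ℕ, (∀ k, τ k ≤ t) →
      TransDim.mtkNorm (TransDim.kpow P t) (TransDim.target Ψ) < 1) ∧
    TransDim.LTwoGeomConvergent P (TransDim.target Ψ) := by
  obtain ⟨s, _, hs⟩ := hΓ
  have hΦ := fun k => TransDim.isProbabilityMeasure_normalized (hΨ k)
  have htarget := TransDim.isProbabilityMeasure_target hΨ
  have hS := TransDim.sum_real_univ_pos hΨ
  have heq := TransDim.target_eq_mixture hΨ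
  have hpos (t : ℕ) (ht : ∀ k, τ k ≤ t) : 0 < t := (hτ (Classical.arbitrary K)).trans_le (ht _)
  have key (t : ℕ) (ht : ∀ k, τ k ≤ t) :
      TransDim.mtkNorm (TransDim.kpow P t) (TransDim.target Ψ) < 1 := by
    rw [heq] at hP ⊢
    refine TransDim.mtkNorm_kpow_mixture_lt_one
      (fun k => div_pos (TransDim.real_univ_pos (hΨ k)) hS) ?_ hP hinv hc
      (fun k z => TransDim.smul_map_le_of_real_le (TransDim.measurableEmbedding_sigmaMk k)
        (hc k).le (hmin k z)) hnorm (TransDim.modelMatrix Ψ P)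
      (fun k k' h => TransDim.lintegral_normalized_pos
        (TransDim.lintegral_pos_of_modelMatrix_pos h)) hs (hpos t ht) ht
    rw [← Finset.sum_div, div_self hS.ne']
  refine ⟨key, ?_⟩
  -- A single contracting power suffices for convergence; the largest `τ k` provides one.
  have hsup (k : K) : τ k ≤ Finset.univ.sup τ := Finset.le_sup (Finset.mem_univ k)
  exact TransDim.lTwoGeomConvergent_of_mtkNorm_lt_one hP (hpos _ hsup) (key _ hsup)
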